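/- For $a\in\mathbb Z^n$ write $t^a=t_1^{a_1}\cdots t_n^{a_n}$. Let $A=\{a_1,\dots,a_m\}\subseteq\mathbb Z^n$ be a nonempty finite set, let $k\in\mathbb N=\{0,1,2,\dots\}$, and for $j\in\mathbb N$ let $$j\cdot A=\Big\{\textstyle\sum_{i=1}^m v_i a_i \ :\ v_1,\dots,v_m\in\mathbb N,\ \sum_{i=1}^m v_i=j\Big\}$$ be the $j$-fold Minkowski sum of $A$. Let $f=\sum_{b\in k\cdot A}c_b t^b\in\mathbb R[t_1^{\pm1},\dots,t_n^{\pm1}]$ be a real Laurent polynomial with support $\operatorname{supp}(f)=\{b : c_b\neq 0\}$ contained in $k\cdot A$, and let $\operatorname{Newt}(f)=\operatorname{conv}(\operatorname{supp}(f))\subseteq\mathbb R^n$ be its Newton polytope (empty if $f=0$). Let $Y_{\hat A}\subseteq\mathbb C^m$ be the Zariski closure of the image of $(\mathbb C^*)^{n+1}\to\mathbb C^m$, $(u,t)\mapsto(ut^{a_1},\dots,ut^{a_m})$, and put $(Y_{\hat A})_{\ge0}=Y_{\hat A}\cap\mathbb R^m_{\ge0}$. Choosing for each $b\in k\cdot A$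 numbers $v_{1b},\dots,v_{mb}\in\mathbb N$ with $\sum_j v_{jb}=k$ and $\sum_j v_{jb}a_j=b$, the polynomial $\sum_{b\in k\cdot A} c_b\, y_1^{v_{1b}}\cdots y_m^{v_{mb}}$ defines a function on $Y_{\hat A}$ that does not depend on the choices. Call $f$ strictly $A$-copositive if this function is positive at every point of $(Y_{\hat A})_{\ge0}\setminus\{0\}$. Then the following are equivalent: (i) $f$ is strictly $A$-copositive. (ii) $\operatorname{Newt}(f)=\operatorname{conv}(k\cdot A)$, and there exists $M\in\mathbb N$ such that $\big(\sum_{i=1}^m t^{a_i}\big)^M f$, which is supported in $(k+M)\cdot A$, has positive coefficients, i.e. the coefficient of $t^b$ is strictly positive for every $b\in(k+M)\cdot A$. (iii) $\operatorname{Newt}(f)=\operatorname{conv}(k\cdot A)$, and there exists $N\in\mathbb N$ such that $\big(\sum_{i=1}^m t^{a_i}\big)^N f$, which is supported in $(k+N)\cdot A$, has nonnegative coefficients. -/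

import Mathlib

namespace SparsePolya

/-- Real Laurent polynomials `ℝ[t₁^±, …, tₙ^±]`; the coefficient of `t^b` in `f` is `f.coeff b`. -/
abbrev Laurent (n : ℕ) : Type := AddMonoidAlgebra ℝ (Fin n → ℤ)

/-- The space of Laurent polynomials whose support is contained in `B`. -/
def laurentOn {n : ℕ} (B : Set (Fin n → ℤ)) : Set (Laurent n) :=
  {f | (f.coeff.support : Set (Fin n → ℤ)) ⊆ B}

/-- `f` has positive coefficients on `B`: every `t^b` with `b ∈ B` appears with a strictly positive
coefficient. -/
def HasPosCoeffs {n : ℕ} (B : Set (Fin n → ℤ)) (f : Laurent n) : Prop :=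
  ∀ b ∈ B, 0 < f.coeff b

/-- All coefficients of `f` are nonnegative. -/
def HasNonnegCoeffs {n : ℕ} (f : Laurent n) : Prop :=
  ∀ b, 0 ≤ f.coeff b

/-- The vector `v = (v_a)` of natural numbers writes `b` as a sum of `k` elements of `A`. -/
def IsDecomp {n : ℕ} (A : Finset (Fin n → ℤ)) (k : ℕ) (b : Fin n → ℤ) (v : A → ℕ) : Prop :=
  ∑ a, v a = k ∧ ∑ a, v a • (a : Fin n → ℤ) = b

/-- The `k`-fold Minkowski sum `k · A = A + ⋯ + A`. -/
def kfold {n : ℕ} (k : ℕ) (A : Finset (Fin n → ℤ)) : Set (Fin n → ℤ) :=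
  {b | ∃ v : A → ℕ, IsDecomp A k b v}

/-- The Laurent polynomial `∑_{a ∈ A} t^a`. -/
noncomputable def monomialSum {n : ℕ} (A : Finset (Fin n → ℤ)) : Laurent n :=
  ∑ a ∈ A, AddMonoidAlgebra.single a 1

/-- The convex hull in `ℝⁿ` of a set of lattice points. -/
def conv {n : ℕ} (B : Set (Fin n → ℤ)) : Set (Fin n → ℝ) :=
  convexHull ℝ ((fun b i => (b i : ℝ)) '' B)

/-- The Newton polytope: the convex hull of the support. -/
def newt {n : ℕ} (f : Laurent n) : Set (Fin n → ℝ) :=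
  conv (f.coeff.support : Set (Fin n → ℤ))

/-- The monomial map `(ℂ^*)^{n+1} → ℂ^A`, `(u, t) ↦ (u t^a)_{a ∈ A}`. -/
noncomputable def monomialMap {n : ℕ} (A : Finset (Fin n → ℤ)) (p : ℂˣ × (Fin n → ℂˣ)) : A → ℂ :=
  fun a => (p.1 : ℂ) * ∏ i, (p.2 i : ℂ) ^ (a : Fin n → ℤ) i

/-- The affine toric variety: the Zariski closure in `ℂ^A` of the image of the monomial map. -/
noncomputable def toricVariety {n : ℕ} (A : Finset (Fin n → ℤ)) : Set (A → ℂ) :=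
  MvPolynomial.zeroLocus ℂ (MvPolynomial.vanishingIdeal ℂ (Set.range (monomialMap A)))

/-- The nonnegative part of the affine toric variety, i.e. its intersection with `ℝ_{≥0}^A`. -/
noncomputable def nonnegToric {n : ℕ} (A : Finset (Fin n → ℤ)) : Set (A → ℝ) :=
  {y | (∀ a, 0 ≤ y a) ∧ (fun a => (y a : ℂ)) ∈ toricVariety A}

/-- `V` chooses for each `b ∈ k · A` a way of writing `b` as a sum of `k` elements of `A`. -/
def IsDecompMatrix {n : ℕ} (A : Finset (Fin n → ℤ)) (k : ℕ)
    (V : (Fin n → ℤ) → A → ℕ) : Prop :=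
  ∀ b ∈ kfold k A, IsDecomp A k b (V b)

/-- The lift `∑_b c_b ∏_a y_a^{V b a}` of `f = ∑_b c_b t^b` to a polynomial in the variables
`y_a`, `a ∈ A`. -/
noncomputable def lift {n : ℕ} {A : Finset (Fin n → ℤ)} (V : (Fin n → ℤ) → A → ℕ)
    (f : Laurent n) : MvPolynomial A ℝ :=
  ∑ b ∈ f.coeff.support, MvPolynomial.C (f.coeff b) * ∏ a, MvPolynomial.X a ^ V b a

/-- `f`, viewed as an element of the space of Laurent polynomials supported in `k · A`, is strictly
`A`-copositive: the function which it induces on the affine toric variety (by any of its lifts; they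
all induce the same function, and there is at least one) is positive on the nonnegative part minus
the origin. -/
def StrictlyCopositive {n : ℕ} (A : Finset (Fin n → ℤ)) (k : ℕ) (f : Laurent n) : Prop :=
  ∀ V : (Fin n → ℤ) → A → ℕ, IsDecompMatrix A k V →
    ∀ y ∈ nonnegToric A, y ≠ 0 → 0 < MvPolynomial.eval y (lift V f)

theorem exists_isDecompMatrix {n : ℕ} (A : Finset (Fin n → ℤ)) (k : ℕ) :
    ∃ V, IsDecompMatrix A k V := by
  classical
  refine ⟨fun b => if h : b ∈ kfold k A then h.choose else 0, fun b hb => ?_⟩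
  simp only [hb, dif_pos]
  exact hb.choose_spec

/-- Two decompositions of the same point give the same monomial function on the toric variety. -/
theorem prod_pow_eq {n : ℕ} {A : Finset (Fin n → ℤ)} {k : ℕ} {b : Fin n → ℤ} {v w : A → ℕ}
    (hv : IsDecomp A k b v) (hw : IsDecomp A k b w) {y : A → ℂ} (hy : y ∈ toricVariety A) :
    ∏ a, y a ^ v a = ∏ a, y a ^ w a := by
  have key : ∀ {v : A → ℕ}, IsDecomp A k b v → ∀ p : ℂˣ × (Fin n → ℂˣ),
      ∏ a, monomialMap A p a ^ v a = (p.1 : ℂ) ^ k * ∏ i, (p.2 i : ℂ) ^ b i := by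
    rintro v ⟨rfl, rfl⟩ p
    simp only [monomialMap, mul_pow, Finset.prod_mul_distrib, Finset.prod_pow_eq_pow_sum,
      ← Finset.prod_pow, Finset.sum_apply, Pi.smul_apply]
    rw [Finset.prod_comm]
    congr 1
    refine Finset.prod_congr rfl fun i _ => ?_
    have h0 : (p.2 i : ℂ) ≠ 0 := (p.2 i).ne_zero
    have : ∀ s : Finset A, ∏ x ∈ s, ((p.2 i : ℂ) ^ (x : Fin n → ℤ) i) ^ v x
        = (p.2 i : ℂ) ^ ∑ x ∈ s, v x • (x : Fin n → ℤ) i := by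
      classical
      intro s
      induction s using Finset.induction_on with
      | empty => simp
      | insert a s ha ih =>
        rw [Finset.prod_insert ha, Finset.sum_insert ha, ih, zpow_add₀ h0, nsmul_eq_mul,
          mul_comm (v a : ℤ), zpow_mul, zpow_natCast]
    exact this _
  have h := hy ((∏ a, MvPolynomial.X a ^ v a) - ∏ a, MvPolynomial.X a ^ w a) (by
    rintro _ ⟨p, rfl⟩
    simp only [map_sub, map_prod, map_pow, MvPolynomial.aeval_X, key hv p, key hw p, sub_self])
  simpa [map_prod, sub_eq_zero] using h

/-- The function on the nonnegative part of the toric variety does not depend on the lift. -/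
theorem eval_lift_eq {n : ℕ} {A : Finset (Fin n → ℤ)} {k : ℕ} {V W : (Fin n → ℤ) → A → ℕ}
    (hV : IsDecompMatrix A k V) (hW : IsDecompMatrix A k W) {f : Laurent n}
    (hf : f ∈ laurentOn (kfold k A)) {y : A → ℝ} (hy : y ∈ nonnegToric A) :
    MvPolynomial.eval y (lift V f) = MvPolynomial.eval y (lift W f) := by
  simp only [lift, map_sum, map_mul, map_prod, map_pow, MvPolynomial.eval_C, MvPolynomial.eval_X]
  refine Finset.sum_congr rfl fun b hb => ?_
  have hb' := hf (Finset.mem_coe.2 hb)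
  have h := prod_pow_eq (hV b hb') (hW b hb') hy.2
  rw [show ∏ a, y a ^ V b a = ∏ a, y a ^ W b a by exact_mod_cast h]

end SparsePolya

namespace SparsePolya

open MvPolynomial Finset Filter Topology

/-! ### Pólya's theorem on the simplex. -/

section Polya

variable {ι : Type*} [Fintype ι]

/-! Lift `f` to a form `F` of degree `k` on `ℝ^A`, and let `σ = ∑ X a`. The toric variety is cut out
by homogeneous binomials (`mem_toricVariety_iff`), and these are killed by `param 1`, the
substitution `y_a ↦ t^a`.

(i) ⇒ (ii): if the Newton polytope were too small, `F` would vanish at the indicator of a face of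
`A`, a nonzero toric point. For the coefficients, adding a large multiple of squared binomials to
`F`, padded by powers of `σ`, gives a form positive on the whole simplex that still maps to a
multiple of `f` by a power of `monomialSum A`. Pólya's theorem makes its coefficients positive after
multiplication by a power of `σ`, and `param 1` adds them up along fibres.

(iii) ⇒ (i): at a nonnegative toric point `y ≠ 0`, substitute `y_a ↦ y_a t^a`. This scales the
coefficients of `monomialSum A ^ N * f` by nonnegative monomial values, and they add up to `σ(y)^N
F(y)`, so `F(y) ≥ 0`. If `F(y) = 0`, all of them vanish. As Laurent polynomials form a domain, every
monomial of `f` then vanishes at `y`, and fullness of the Newton polytope forces `y = 0`. -/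

theorem coeff_sum_X_pow_mul_factorial (M : ℕ) (w : ι →₀ ℕ) (hw : ∑ i, w i = M) :
    coeff w ((∑ i, X i : MvPolynomial ι ℝ) ^ M) * ∏ i, ((w i).factorial : ℝ) = M.factorial := by
  classical
  have h : coeff w ((∑ i, X i : MvPolynomial ι ℝ) ^ M) = Nat.multinomial univ w := by
    rw [Finset.sum_pow_eq_sum_piAntidiag, coeff_sum, Finset.sum_eq_single (w : ι → ℕ)]
    · rw [← map_natCast (C : ℝ →+* MvPolynomial ι ℝ), coeff_C_mul, prod_X_pow, coeff_monomial,
        if_pos, mul_one]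
      ext; simp [Finsupp.indicator_apply]
    · intro v _ hv
      rw [← map_natCast (C : ℝ →+* MvPolynomial ι ℝ), coeff_C_mul, prod_X_pow, coeff_monomial,
        if_neg, mul_zero]
      rintro rfl
      apply hv
      ext; simp [Finsupp.indicator_apply]
    · intro h
      exact absurd (by simp [mem_piAntidiag, hw]) h
  rw [h, mul_comm, ← hw]
  exact_mod_cast Nat.multinomial_spec univ w

theorem sum_eq_of_mem_support {d : ℕ} {G : MvPolynomial ι ℝ} (hG : G.IsHomogeneous d)
    {α : ι →₀ ℕ} (hα : α ∈ G.support) : ∑ i, α i = d := by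
  have h := hG (mem_support_iff.1 hα)
  rwa [show (1 : ι → ℕ) = fun _ => 1 from rfl, ← Finsupp.degree_eq_weight_one,
    Finsupp.degree_eq_sum] at h

/-- The term `α` contributes `M! / (v - α)!`, and `v! / (v - α)!` is a falling factorial. The latter
is zero unless `α ≤ v`, so the sum needs no restriction. -/
theorem coeff_sum_X_pow_mul_mul_factorial {d : ℕ} {G : MvPolynomial ι ℝ} (hG : G.IsHomogeneous d)
    (M : ℕ) (v : ι →₀ ℕ) (hv : ∑ i, v i = M + d) :
    coeff v ((∑ i, X i) ^ M * G) * ∏ i, ((v i).factorial : ℝ) =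
      M.factorial * ∑ α ∈ G.support, coeff α G * ∏ i, ((v i).descFactorial (α i) : ℝ) := by
  classical
  conv_lhs => rw [G.as_sum]
  rw [Finset.mul_sum, coeff_sum, Finset.sum_mul, Finset.mul_sum]
  refine Finset.sum_congr rfl fun α hα => ?_
  have hd := sum_eq_of_mem_support hG hα
  rw [coeff_mul_monomial']
  split_ifs with hle
  · have h1 : ∑ i, (v - α) i = M := by
      have : ∑ i, (v - α) i + ∑ i, α i = ∑ i, v i := by
        rw [← Finset.sum_add_distrib]
        exact Finset.sum_congr rfl fun i _ => by
          simpa using Nat.sub_add_cancel (hle i)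
      omega
    have h2 := coeff_sum_X_pow_mul_factorial M (v - α) h1
    have h3 : ∏ i, ((v i).factorial : ℝ) =
        (∏ i, (((v - α) i).factorial : ℝ)) * ∏ i, ((v i).descFactorial (α i) : ℝ) := by
      rw [← Finset.prod_mul_distrib]
      refine Finset.prod_congr rfl fun i _ => ?_
      rw [← Nat.factorial_mul_descFactorial (hle i)]
      push_cast
      simp
    rw [h3, ← h2]
    ring
  · obtain ⟨i, hi⟩ : ∃ i, v i < α i := by
      by_contra! h
      exact hle h
    have h0 : ∏ i, ((v i).descFactorial (α i) : ℝ) = 0 :=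
      Finset.prod_eq_zero (mem_univ i) (by simp [Nat.descFactorial_eq_zero_iff_lt.2 hi])
    simp [h0]

theorem cast_descFactorial_eq_prod (m a : ℕ) :
    (m.descFactorial a : ℝ) = ∏ l ∈ range a, ((m : ℝ) - l) := by
  induction a with
  | zero => simp
  | succ a ih =>
    rw [Nat.descFactorial_succ, Finset.prod_range_succ, ← ih]
    push_cast
    rcases le_or_gt a m with h | h
    · rw [Nat.cast_sub h, mul_comm]
    · simp [Nat.descFactorial_eq_zero_iff_lt.2 h]

/-- **Pólya's theorem** on forms that are positive on the standard simplex. -/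
theorem exists_pow_mul_coeff_pos {d : ℕ} {G : MvPolynomial ι ℝ} (hG : G.IsHomogeneous d)
    (hpos : ∀ x ∈ stdSimplex ℝ ι, 0 < eval x G) :
    ∃ M : ℕ, ∀ v : ι →₀ ℕ, ∑ i, v i = M + d → 0 < coeff v ((∑ i, X i) ^ M * G) := by
  -- A deformation of `G = H 0`: rescaled by `N = M + d`, the falling factorials at `v` give exactly
  -- `H N⁻¹` at `v / N`. Compactness of the simplex keeps `H ε` positive for small `ε`.
  let H : ℝ → (ι → ℝ) → ℝ := fun ε x =>
    ∑ α ∈ G.support, coeff α G * ∏ i, ∏ l ∈ range (α i), (x i - l * ε)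
  have hH : Continuous fun z : ℝ × (ι → ℝ) => H z.1 z.2 := by
    simp only [H]; fun_prop
  have hev : ∀ᶠ ε in 𝓝 (0 : ℝ), ∀ x ∈ stdSimplex ℝ ι, 0 < H ε x := by
    refine (isCompact_stdSimplex (𝕜 := ℝ) ι).eventually_forall_of_forall_eventually fun x hx => ?_
    refine (hH.tendsto (0, x)).eventually_const_lt ?_
    have := hpos x hx
    rw [eval_eq'] at this
    simpa [H] using this
  have htend : Tendsto (fun M : ℕ => (((M + d : ℕ) : ℝ))⁻¹) atTop (𝓝 0) :=
    (tendsto_inv_atTop_nhds_zero_nat (𝕜 := ℝ)).comp (tendsto_add_atTop_nat d)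
  -- `M ≥ 1` keeps `M + d` nonzero when `d = 0`.
  obtain ⟨M, hM, hM1⟩ := ((htend.eventually hev).and (eventually_ge_atTop 1)).exists
  refine ⟨M, fun v hv => ?_⟩
  have hN : (0 : ℝ) < ((M + d : ℕ) : ℝ) := by positivity
  set N : ℝ := ((M + d : ℕ) : ℝ) with hNdef
  have hx : (fun i => (v i : ℝ) / N) ∈ stdSimplex ℝ ι := by
    refine ⟨fun i => by positivity, ?_⟩
    rw [← Finset.sum_div, ← Nat.cast_sum, hv, div_self hN.ne']
  have key := hM _ hx
  have hcoef := coeff_sum_X_pow_mul_mul_factorial hG M v hv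
  have hsum : ∑ α ∈ G.support, coeff α G * ∏ i, ((v i).descFactorial (α i) : ℝ) =
      N ^ d * H N⁻¹ (fun i => (v i : ℝ) / N) := by
    simp only [H, Finset.mul_sum]
    refine Finset.sum_congr rfl fun α hα => ?_
    have hd := sum_eq_of_mem_support hG hα
    rw [mul_left_comm, ← hd, ← Finset.prod_pow_eq_pow_sum, ← Finset.prod_mul_distrib]
    congr 1
    refine Finset.prod_congr rfl fun i _ => ?_
    rw [cast_descFactorial_eq_prod, ← Finset.card_range (α i), ← Finset.prod_const,
      Finset.card_range, ← Finset.prod_mul_distrib]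
    refine Finset.prod_congr rfl fun l _ => ?_
    field_simp
  rw [hsum] at hcoef
  have hf : (0 : ℝ) < ∏ i, ((v i).factorial : ℝ) :=
    Finset.prod_pos fun i _ => by exact_mod_cast (v i).factorial_pos
  have : 0 < coeff v ((∑ i, X i) ^ M * G) * ∏ i, ((v i).factorial : ℝ) := by
    rw [hcoef]
    have := M.factorial_pos
    positivity
  exact pos_of_mul_pos_left this hf.le

end Polya

/-! ### Binomial equations of the toric variety and monomial substitutions. -/

section Toric

variable {n : ℕ} {A : Finset (Fin n → ℤ)}

/-- The lattice point `∑ a, v a • a`. -/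
def latticeSum (v : A → ℕ) : Fin n → ℤ := ∑ a, v a • (a : Fin n → ℤ)

/-- The point `y` satisfies the homogeneous binomial equations of the toric variety. -/
def SatisfiesBinomials {R : Type*} [CommSemiring R] (y : A → R) : Prop :=
  ∀ (d : ℕ) (b : Fin n → ℤ) (v w : A → ℕ), IsDecomp A d b v → IsDecomp A d b w →
    ∏ a, y a ^ v a = ∏ a, y a ^ w a

theorem isDecomp_latticeSum (v : A → ℕ) : IsDecomp A (∑ a, v a) (latticeSum v) v := ⟨rfl, rfl⟩

/-- The character `(u, t) ↦ u ^ d * t ^ b` of the torus. -/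
noncomputable def torusChar (q : ℕ × (Fin n → ℤ)) : ℂˣ × (Fin n → ℂˣ) →* ℂ where
  toFun p := (p.1 : ℂ) ^ q.1 * ∏ i, (p.2 i : ℂ) ^ q.2 i
  map_one' := by simp
  map_mul' p p' := by
    simp only [Prod.fst_mul, Prod.snd_mul, Pi.mul_apply, Units.val_mul, mul_pow, mul_zpow,
      Finset.prod_mul_distrib]
    ring

theorem torusChar_injective : Function.Injective (torusChar (n := n)) := by
  rintro ⟨d, b⟩ ⟨d', b'⟩ h
  have h2 : (2 : ℂ) ≠ 0 := two_ne_zero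
  have hd : d = d' := by
    have := DFunLike.congr_fun h (Units.mk0 2 h2, 1)
    have h' : (2 : ℂ) ^ d = 2 ^ d' := by simpa [torusChar] using this
    exact Nat.pow_right_injective le_rfl (by exact_mod_cast h')
  have hb : b = b' := by
    funext i
    have := DFunLike.congr_fun h (1, Pi.mulSingle i (Units.mk0 2 h2))
    have hprod : ∀ c : Fin n → ℤ,
        ∏ j, ((Pi.mulSingle (M := fun _ => ℂˣ) i (Units.mk0 2 h2) j : ℂˣ) : ℂ) ^ c j
          = 2 ^ c i := by
      intro c
      rw [Finset.prod_eq_single i]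
      · simp
      · intro j _ hj
        simp [Pi.mulSingle_eq_of_ne hj]
      · simp
    have h' : (2 : ℂ) ^ b i = 2 ^ b' i := by
      simpa [torusChar, hprod] using this
    have h'' : (2 : ℝ) ^ b i = 2 ^ b' i := Complex.ofReal_injective (by push_cast; exact h')
    exact zpow_right_injective₀ (by norm_num) (by norm_num) h''
  rw [hd, hb]

theorem prod_monomialMap_pow (v : A → ℕ) (p : ℂˣ × (Fin n → ℂˣ)) :
    ∏ a, monomialMap A p a ^ v a = torusChar (∑ a, v a, latticeSum v) p := by
  simp only [monomialMap, mul_pow, Finset.prod_mul_distrib, Finset.prod_pow_eq_pow_sum,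
    ← Finset.prod_pow, torusChar, MonoidHom.coe_mk, OneHom.coe_mk, latticeSum, Finset.sum_apply,
    Pi.smul_apply]
  rw [Finset.prod_comm]
  congr 1
  refine Finset.prod_congr rfl fun i _ => ?_
  have hsum : ∀ s : Finset A, ∏ x ∈ s, ((p.2 i : ℂ) ^ (x : Fin n → ℤ) i) ^ v x =
      (p.2 i : ℂ) ^ ∑ x ∈ s, v x • (x : Fin n → ℤ) i := by
    classical
    intro s
    induction s using Finset.induction_on with
    | empty => simp
    | insert a s ha ih =>
      rw [Finset.prod_insert ha, Finset.sum_insert ha, ih, zpow_add₀ (p.2 i).ne_zero,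
        nsmul_eq_mul, mul_comm (v a : ℤ), zpow_mul, zpow_natCast]
  exact hsum _

/-- Group the monomials of a polynomial vanishing on the torus by the character they restrict to.
Distinct characters are linearly independent (Dedekind), so the coefficients in each group sum to
zero; the binomials make all monomials of a group agree at `y`. -/
theorem mem_toricVariety_iff {y : A → ℂ} : y ∈ toricVariety A ↔ SatisfiesBinomials y := by
  classical
  refine ⟨fun h d b v w hv hw => prod_pow_eq hv hw h, fun h p hp => ?_⟩
  let key : (A →₀ ℕ) → ℕ × (Fin n → ℤ) := fun v => (∑ a, v a, latticeSum v)
  let g : ℕ × (Fin n → ℤ) → ℂ := fun q => ∑ v ∈ p.support with key v = q, coeff v p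
  have hli : LinearIndependent ℂ
      fun q : ℕ × (Fin n → ℤ) => (torusChar q : ℂˣ × (Fin n → ℂˣ) → ℂ) :=
    (linearIndependent_monoidHom (ℂˣ × (Fin n → ℂˣ)) ℂ).comp _ torusChar_injective
  have hmaps : ∀ v ∈ p.support, key v ∈ p.support.image key := fun v hv => mem_image_of_mem _ hv
  have hg : ∀ q ∈ p.support.image key, g q = 0 := by
    refine linearIndependent_iff'.1 hli _ g ?_
    funext t
    have ht := hp _ ⟨t, rfl⟩
    rw [aeval_eq_eval, eval_eq'] at ht
    simp only [prod_monomialMap_pow] at ht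
    simp only [Finset.sum_apply, Pi.smul_apply, smul_eq_mul, g, Finset.sum_mul, Pi.zero_apply]
    rw [← ht, ← Finset.sum_fiberwise_of_maps_to hmaps]
    refine Finset.sum_congr rfl fun q _ => Finset.sum_congr rfl fun v hv => ?_
    rw [← (Finset.mem_filter.1 hv).2]
  rw [aeval_eq_eval, eval_eq', ← Finset.sum_fiberwise_of_maps_to hmaps]
  refine Finset.sum_eq_zero fun q hq => ?_
  obtain ⟨w, -, rfl⟩ := Finset.mem_image.1 hq
  have : ∀ v ∈ p.support.filter (fun v => key v = key w),
      coeff v p * ∏ i, y i ^ v i = coeff v p * ∏ i, y i ^ w i := by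
    intro v hv
    have hvw := (Finset.mem_filter.1 hv).2
    simp only [key, Prod.mk.injEq] at hvw
    rw [h (∑ a, w a) (latticeSum w) v w ⟨hvw.1, hvw.2⟩ (isDecomp_latticeSum _)]
  rw [Finset.sum_congr rfl this, ← Finset.sum_mul, show ∑ v ∈ p.support with key v = key w,
    coeff v p = 0 from hg _ hq, zero_mul]

theorem mem_nonnegToric_iff {y : A → ℝ} :
    y ∈ nonnegToric A ↔ (∀ a, 0 ≤ y a) ∧ SatisfiesBinomials y := by
  refine and_congr_right fun _ => mem_toricVariety_iff.trans ?_
  refine forall₄_congr fun d b v w => forall₂_congr fun _ _ => ?_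
  beta_reduce
  norm_cast

/-- The substitution `y_a ↦ c_a t^a`. -/
noncomputable def param (c : A → ℝ) : MvPolynomial A ℝ →ₐ[ℝ] Laurent n :=
  aeval fun a => AddMonoidAlgebra.single (a : Fin n → ℤ) (c a)

theorem single_finset_prod {ι : Type*} (s : Finset ι) (b : ι → Fin n → ℤ) (r : ι → ℝ) :
    ∏ i ∈ s, (AddMonoidAlgebra.single (b i) (r i) : Laurent n) =
      AddMonoidAlgebra.single (∑ i ∈ s, b i) (∏ i ∈ s, r i) := by
  classical
  induction s using Finset.induction_on with
  | empty => simp [AddMonoidAlgebra.one_def]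
  | insert a s ha ih =>
    rw [Finset.prod_insert ha, Finset.sum_insert ha, Finset.prod_insert ha, ih,
      AddMonoidAlgebra.single_mul_single]

theorem param_prod_X_pow (c : A → ℝ) (v : A → ℕ) :
    param c (∏ a, X a ^ v a) = AddMonoidAlgebra.single (latticeSum v) (∏ a, c a ^ v a) := by
  simp only [param, map_prod, map_pow, aeval_X, AddMonoidAlgebra.single_pow, single_finset_prod]
  rfl

theorem param_eq_sum (c : A → ℝ) (P : MvPolynomial A ℝ) :
    param c P = ∑ v ∈ P.support,
      AddMonoidAlgebra.single (latticeSum v) (coeff v P * ∏ a, c a ^ v a) := by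
  conv_lhs => rw [P.as_sum]
  rw [map_sum]
  refine Finset.sum_congr rfl fun v _ => ?_
  rw [monomial_eq, Finsupp.prod_fintype _ _ (by simp), map_mul, param_prod_X_pow, param,
    ← algebraMap_eq, AlgHom.commutes, ← Algebra.smul_def, AddMonoidAlgebra.smul_single,
    smul_eq_mul]

theorem coeff_param (c : A → ℝ) (P : MvPolynomial A ℝ) (b : Fin n → ℤ) :
    (param c P).coeff b =
      ∑ v ∈ P.support with latticeSum (v : A →₀ ℕ) = b, coeff v P * ∏ a, c a ^ v a := by
  classical
  rw [param_eq_sum, AddMonoidAlgebra.coeff_sum, Finsupp.finsetSum_apply, Finset.sum_filter]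
  exact Finset.sum_congr rfl fun v _ => Finsupp.single_apply

theorem param_one_mem_laurentOn {d : ℕ} {P : MvPolynomial A ℝ} (hP : P.IsHomogeneous d) :
    param 1 P ∈ laurentOn (kfold d A) := by
  intro b hb
  rw [Finset.mem_coe, Finsupp.mem_support_iff, coeff_param] at hb
  obtain ⟨v, hv, -⟩ := Finset.exists_ne_zero_of_sum_ne_zero hb
  rw [Finset.mem_filter] at hv
  exact ⟨v, sum_eq_of_mem_support hP hv.1, hv.2⟩

/-- The monomials of `P` above `t^b` all have degree `d`, so the binomials give them one common
value at `y`, which factors out. -/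
theorem coeff_param_eq {d : ℕ} {P : MvPolynomial A ℝ} (hP : P.IsHomogeneous d) {y : A → ℝ}
    (hy : SatisfiesBinomials y) {b : Fin n → ℤ} {w : A → ℕ} (hw : IsDecomp A d b w) :
    (param y P).coeff b = (param 1 P).coeff b * ∏ a, y a ^ w a := by
  simp only [coeff_param, Finset.sum_mul]
  refine Finset.sum_congr rfl fun v hv => ?_
  rw [Finset.mem_filter] at hv
  rw [hy d b v w ⟨sum_eq_of_mem_support hP hv.1, hv.2⟩ hw]
  simp

theorem coeff_param_eq_zero {d : ℕ} {P : MvPolynomial A ℝ} (hP : P.IsHomogeneous d) (y : A → ℝ)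
    {b : Fin n → ℤ} (hb : b ∉ kfold d A) : (param y P).coeff b = 0 := by
  rw [coeff_param]
  refine Finset.sum_eq_zero fun v hv => ?_
  rw [Finset.mem_filter] at hv
  exact absurd ⟨v, sum_eq_of_mem_support hP hv.1, hv.2⟩ hb

/-- Setting `t = 1` after `y_a ↦ c_a t^a` is evaluation at `c`. -/
theorem sum_coeff_param (c : A → ℝ) (P : MvPolynomial A ℝ) :
    (param c P).coeff.sum (fun _ r => r) = eval c P := by
  have h : (AddMonoidAlgebra.lift ℝ ℝ (Fin n → ℤ) 1).comp (param c) = aeval c := by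
    ext a
    simp [param]
  have := DFunLike.congr_fun h P
  rw [AlgHom.comp_apply, AddMonoidAlgebra.lift_apply] at this
  simpa [aeval_eq_eval] using this

theorem param_one_sum_X : param 1 (∑ a : A, X a) = monomialSum A := by
  simp only [param, map_sum, aeval_X, monomialSum, Pi.one_apply]
  exact Finset.sum_coe_sort A fun a => (AddMonoidAlgebra.single a 1 : Laurent n)

theorem lift_isHomogeneous {k : ℕ} {V : (Fin n → ℤ) → A → ℕ} (hV : IsDecompMatrix A k V)
    {f : Laurent n} (hf : f ∈ laurentOn (kfold k A)) : (lift V f).IsHomogeneous k := by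
  refine IsHomogeneous.sum _ _ _ fun b hb => ?_
  rw [← zero_add k, ← (hV b (hf (Finset.mem_coe.2 hb))).1]
  exact (isHomogeneous_C _ _).mul
    (IsHomogeneous.prod _ _ _ fun a _ => by simpa using (isHomogeneous_X ℝ a).pow (V b a))

theorem param_one_lift {k : ℕ} {V : (Fin n → ℤ) → A → ℕ} (hV : IsDecompMatrix A k V)
    {f : Laurent n} (hf : f ∈ laurentOn (kfold k A)) : param 1 (lift V f) = f := by
  conv_rhs => rw [← AddMonoidAlgebra.sum_coeff_single f, Finsupp.sum]
  rw [lift, map_sum]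
  refine Finset.sum_congr rfl fun b hb => ?_
  rw [map_mul, param_prod_X_pow, param, ← algebraMap_eq, AlgHom.commutes, ← Algebra.smul_def,
    AddMonoidAlgebra.smul_single]
  simp only [Pi.one_apply, one_pow, Finset.prod_const_one, smul_eq_mul, mul_one]
  congr 1
  exact (hV b (hf (Finset.mem_coe.2 hb))).2

end Toric

/-! ### Rational convex combinations of lattice points. -/

section Convex

variable {n : ℕ}

/-- A lattice point in the real convex hull of lattice points is a rational convex combination. -/
theorem exists_nat_combination {ι : Type*} [Fintype ι] (b : ι → Fin n → ℤ) (x : Fin n → ℤ)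
    (w : ι → ℝ) (hw : ∀ i, 0 ≤ w i) (hw1 : ∑ i, w i = 1)
    (hx : ∀ j, ∑ i, w i * (b i j : ℝ) = x j) :
    ∃ m : ι → ℕ, (∃ i, 0 < m i) ∧ ∑ i, m i • b i = (∑ i, m i) • x := by
  -- Simultaneous Diophantine approximation: by compactness, two multiples `D₁ < D₂` of `w` have
  -- nearly equal fractional parts, so the differences of their floors are nearly proportional to
  -- `w`.
  let u : ℕ → ι → ℝ := fun D i => Int.fract (D * w i)
  have hu : ∀ D, u D ∈ Set.univ.pi fun _ : ι => Set.Icc (0 : ℝ) 1 := fun D i _ =>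
    ⟨Int.fract_nonneg _, (Int.fract_lt_one _).le⟩
  obtain ⟨z, -, φ, hφ, hlim⟩ := (isCompact_univ_pi fun _ : ι => isCompact_Icc).tendsto_subseq hu
  -- Large enough that an error of `B⁻¹` per weight neither makes all `m i` zero nor moves an
  -- integer coordinate by 1.
  let B : ℝ := 1 + Fintype.card ι + ∑ i, ∑ j, |(b i j : ℝ) - x j|
  have hS : 0 ≤ ∑ i, ∑ j, |(b i j : ℝ) - x j| := by positivity
  have hB : 0 < B := by positivity
  obtain ⟨p, hp⟩ := Metric.cauchySeq_iff'.1 hlim.cauchySeq B⁻¹ (by positivity)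
  have hdist := hp (p + 1) (by omega)
  have hlt : φ p < φ (p + 1) := hφ (by omega)
  set D₁ := φ p
  set D₂ := φ (p + 1)
  let δ : ι → ℝ := fun i => u D₂ i - u D₁ i
  have hδ : ∀ i, |δ i| ≤ B⁻¹ := fun i => by
    have := (dist_le_pi_dist (u D₂) (u D₁) i).trans hdist.le
    rwa [Real.dist_eq] at this
  have hmono : ∀ i, ⌊(D₁ : ℝ) * w i⌋ ≤ ⌊(D₂ : ℝ) * w i⌋ := fun i =>
    Int.floor_mono (mul_le_mul_of_nonneg_right (by exact_mod_cast hlt.le) (hw i))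
  let m : ι → ℕ := fun i => (⌊(D₂ : ℝ) * w i⌋ - ⌊(D₁ : ℝ) * w i⌋).toNat
  have hmz : ∀ i, (m i : ℤ) = ⌊(D₂ : ℝ) * w i⌋ - ⌊(D₁ : ℝ) * w i⌋ := fun i =>
    Int.toNat_of_nonneg (sub_nonneg.2 (hmono i))
  have hm : ∀ i, (m i : ℝ) = ((D₂ : ℝ) - D₁) * w i - δ i := fun i => by
    have h1 : (m i : ℝ) = ((m i : ℤ) : ℝ) := by simp
    rw [h1, hmz]
    push_cast
    simp only [δ, u, Int.fract]
    ring
  refine ⟨m, ?_, ?_⟩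
  · by_contra! h0
    have hz : ∑ i, (m i : ℝ) = 0 := Finset.sum_eq_zero fun i _ => by
      exact_mod_cast Nat.le_zero.1 (h0 i)
    simp only [hm, Finset.sum_sub_distrib, ← Finset.mul_sum, hw1, mul_one] at hz
    have h1 : ∑ i, δ i ≤ Fintype.card ι * B⁻¹ := by
      have := Finset.sum_le_sum fun i (_ : i ∈ univ) => (le_abs_self _).trans (hδ i)
      simpa using this
    have h2 : (1 : ℝ) ≤ (D₂ : ℝ) - D₁ := by
      have : ((D₁ + 1 : ℕ) : ℝ) ≤ D₂ := by exact_mod_cast hlt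
      push_cast at this
      linarith
    have h3 : Fintype.card ι * B⁻¹ < 1 := by
      rw [← div_eq_mul_inv, div_lt_one hB]
      simp only [B]
      linarith
    linarith
  · funext j
    have h1 : ∑ i, (m i : ℝ) * ((b i j : ℝ) - x j) = -∑ i, δ i * ((b i j : ℝ) - x j) := by
      have h2 : ∑ i, w i * ((b i j : ℝ) - x j) = 0 := by
        simp only [mul_sub, Finset.sum_sub_distrib, hx, ← Finset.sum_mul, hw1]
        ring
      simp only [hm, sub_mul, Finset.sum_sub_distrib, mul_assoc, ← Finset.mul_sum, h2]
      ring
    have h4 : |∑ i, δ i * ((b i j : ℝ) - x j)| < 1 := by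
      calc |∑ i, δ i * ((b i j : ℝ) - x j)|
          ≤ ∑ i, |δ i * ((b i j : ℝ) - x j)| := Finset.abs_sum_le_sum_abs _ _
        _ ≤ ∑ i, B⁻¹ * ∑ j, |(b i j : ℝ) - x j| := by
          refine Finset.sum_le_sum fun i _ => ?_
          rw [abs_mul]
          refine mul_le_mul (hδ i) ?_ (abs_nonneg _) (by positivity)
          exact Finset.single_le_sum (f := fun j => |(b i j : ℝ) - x j|)
            (fun _ _ => abs_nonneg _) (mem_univ j)
        _ < 1 := by
          rw [← Finset.mul_sum, inv_mul_lt_one₀ hB]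
          have : (0 : ℝ) ≤ Fintype.card ι := by positivity
          simp only [B]
          linarith
    have h5 : |∑ i, (m i : ℤ) * (b i j - x j)| < 1 := by
      rw [← abs_neg, ← h1] at h4
      exact_mod_cast h4
    rw [Int.abs_lt_one_iff] at h5
    simp only [mul_sub, Finset.sum_sub_distrib, ← Finset.sum_mul] at h5
    rw [Finset.sum_apply, Pi.smul_apply, nsmul_eq_mul, Nat.cast_sum, ← sub_eq_zero, ← h5]
    simp only [Pi.smul_apply, nsmul_eq_mul]

/-- The inclusion of the lattice into real space. -/
def latticeToReal (b : Fin n → ℤ) : Fin n → ℝ := fun i => (b i : ℝ)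

theorem latticeToReal_sum_smul {ι : Type*} (s : Finset ι) (m : ι → ℕ) (b : ι → Fin n → ℤ) :
    latticeToReal (∑ i ∈ s, m i • b i) = ∑ i ∈ s, (m i : ℝ) • latticeToReal (b i) := by
  funext j
  simp [latticeToReal]

theorem exists_nat_combination_of_mem_conv {S : Set (Fin n → ℤ)} {x : Fin n → ℤ}
    (hx : latticeToReal x ∈ conv S) :
    ∃ (ι : Type) (_ : Fintype ι) (b : ι → Fin n → ℤ) (m : ι → ℕ), (∀ i, b i ∈ S) ∧
      (∃ i, 0 < m i) ∧ ∑ i, m i • b i = (∑ i, m i) • x := by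
  obtain ⟨ι, _, w, z, hw, hw1, hz, hzx⟩ := mem_convexHull_iff_exists_fintype.1 hx
  choose b hbS hbz using hz
  obtain ⟨m, hm⟩ := exists_nat_combination b x w hw hw1 fun j => by
    have := congrFun hzx j
    simp only [← hbz, Finset.sum_apply, Pi.smul_apply, smul_eq_mul] at this
    exact this
  exact ⟨ι, inferInstance, b, m, hbS, hm⟩

end Convex

/-! ### The implications between copositivity and coefficient conditions. -/

section Main

variable {n : ℕ} {A : Finset (Fin n → ℤ)} {k : ℕ} {f : Laurent n}

/-- Since `0 ^ 0 = 1`, the product is 1 exactly when `v` is supported on the face `l = μ`, the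
equality case of `∑ v a * l a ≤ (∑ v a) * μ`. -/
theorem prod_indicator_pow (l : (Fin n → ℝ) →ₗ[ℝ] ℝ) {μ : ℝ}
    (hμ : ∀ a ∈ A, l (latticeToReal a) ≤ μ) (v : A → ℕ) :
    ∏ a : A, (if l (latticeToReal a) = μ then 1 else 0 : ℝ) ^ v a =
      if l (latticeToReal (latticeSum v)) = (∑ a, v a : ℕ) * μ then 1 else 0 := by
  have hl : l (latticeToReal (latticeSum v)) = ∑ a : A, (v a : ℝ) * l (latticeToReal a) := by
    rw [latticeSum, latticeToReal_sum_smul, map_sum]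
    simp
  have hle : ∀ a ∈ (univ : Finset A), (v a : ℝ) * l (latticeToReal a) ≤ v a * μ := fun a _ =>
    mul_le_mul_of_nonneg_left (hμ a a.2) (Nat.cast_nonneg _)
  rw [hl, Nat.cast_sum, Finset.sum_mul]
  split_ifs with h
  · refine Finset.prod_eq_one fun a ha => ?_
    rcases eq_or_ne (v a) 0 with h0 | h0
    · simp [h0]
    · have := (Finset.sum_eq_sum_iff_of_le hle).1 h a ha
      rw [if_pos (mul_left_cancel₀ (by exact_mod_cast h0) this), one_pow]
  · obtain ⟨a, -, ha⟩ : ∃ a ∈ (univ : Finset A),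
        (v a : ℝ) * l (latticeToReal a) ≠ v a * μ := by
      by_contra! h'
      exact h (Finset.sum_congr rfl h')
    refine Finset.prod_eq_zero (mem_univ a) ?_
    rw [if_neg (fun h' => ha (by rw [h'])), zero_pow]
    rintro h0
    exact ha (by simp [h0])

theorem indicator_mem_nonnegToric (l : (Fin n → ℝ) →ₗ[ℝ] ℝ) {μ : ℝ}
    (hμ : ∀ a ∈ A, l (latticeToReal a) ≤ μ) :
    (fun a : A => if l (latticeToReal a) = μ then 1 else 0 : A → ℝ) ∈ nonnegToric A := by
  refine mem_nonnegToric_iff.2 ⟨fun a => by split_ifs <;> norm_num, ?_⟩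
  intro d b v w hv hw
  rw [prod_indicator_pow l hμ, prod_indicator_pow l hμ, hv.1, hw.1,
    show latticeSum v = b from hv.2, show latticeSum w = b from hw.2]

theorem eval_lift (V : (Fin n → ℤ) → A → ℕ) (y : A → ℝ) :
    eval y (lift V f) = ∑ b ∈ f.coeff.support, f.coeff b * ∏ a, y a ^ V b a := by
  simp [lift]

/-- Separate a missing point `b₀` from the polytope by `l`. The support of `f` then stays strictly
below `k * max l`, so every monomial of the lift vanishes at the indicator of the face of `A`
maximizing `l`. -/
theorem newt_eq_conv_of_strictlyCopositive (hA : A.Nonempty) (hf : f ∈ laurentOn (kfold k A))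
    (h : StrictlyCopositive A k f) : newt f = conv (kfold k A) := by
  refine Set.Subset.antisymm (convexHull_mono (Set.image_mono hf))
    (convexHull_min ?_ (convex_convexHull ℝ _))
  rintro _ ⟨b₀, hb₀, rfl⟩
  by_contra hb
  have hclosed : IsClosed (newt f) :=
    ((f.coeff.support.finite_toSet.image _).isCompact_convexHull ℝ).isClosed
  obtain ⟨l, u, hlu, hub⟩ :=
    geometric_hahn_banach_closed_point (convex_convexHull ℝ _) hclosed hb
  obtain ⟨a₀, ha₀, hmax⟩ := A.exists_max_image (fun a => l (latticeToReal a)) hA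
  obtain ⟨V, hV⟩ := exists_isDecompMatrix A k
  have hb₀le : l (latticeToReal b₀) ≤ k * l (latticeToReal a₀) := by
    obtain ⟨v, rfl, rfl⟩ := hb₀
    rw [latticeToReal_sum_smul, map_sum, Nat.cast_sum, Finset.sum_mul]
    refine Finset.sum_le_sum fun a _ => ?_
    rw [map_smul, smul_eq_mul]
    exact mul_le_mul_of_nonneg_left (hmax a a.2) (Nat.cast_nonneg _)
  have hpos := h V hV _ (indicator_mem_nonnegToric (l : (Fin n → ℝ) →ₗ[ℝ] ℝ) hmax) (fun h0 => by
    simpa using congrFun h0 ⟨a₀, ha₀⟩)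
  rw [eval_lift, Finset.sum_eq_zero] at hpos
  · exact lt_irrefl _ hpos
  · intro b hbs
    have hVb := hV b (hf (Finset.mem_coe.2 hbs))
    rw [prod_indicator_pow (l : (Fin n → ℝ) →ₗ[ℝ] ℝ) hmax, hVb.1,
      show latticeSum (V b) = b from hVb.2, if_neg, mul_zero]
    have h1 : l (latticeToReal b) < u :=
      hlu _ (subset_convexHull ℝ _ ⟨b, Finset.mem_coe.2 hbs, rfl⟩)
    exact (h1.trans (hub.trans_le hb₀le)).ne

theorem exists_forall_add_mul_pos {X : Type*} [TopologicalSpace X] {K : Set X} (hK : IsCompact K)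
    {F h : X → ℝ} (hF : Continuous F) (hh : Continuous h) (h0 : ∀ x, 0 ≤ h x)
    (hpos : ∀ x ∈ K, 0 < F x ∨ 0 < h x) : ∃ c : ℕ, ∀ x ∈ K, 0 < F x + c * h x := by
  refine hK.elim_directed_cover (fun c : ℕ => {x | 0 < F x + c * h x})
    (fun c => isOpen_lt (by fun_prop) (by fun_prop)) (fun x hx => ?_) (Monotone.directed_le ?_)
  · rw [Set.mem_iUnion]
    rcases (h0 x).lt_or_eq with hx0 | hx0
    · obtain ⟨c, hc⟩ := exists_nat_gt (-F x / h x)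
      refine ⟨c, ?_⟩
      rw [div_lt_iff₀ hx0] at hc
      show 0 < F x + c * h x
      linarith
    · refine ⟨0, ?_⟩
      have := (hpos x hx).resolve_right (by simp [← hx0])
      simpa using this
  · intro c c' hcc x hx
    have : (c : ℝ) * h x ≤ c' * h x :=
      mul_le_mul_of_nonneg_right (by exact_mod_cast hcc) (h0 x)
    show 0 < F x + c' * h x
    have hx' : 0 < F x + c * h x := hx
    linarith

theorem prod_X_pow_isHomogeneous (v : A → ℕ) :
    (∏ a, X a ^ v a : MvPolynomial A ℝ).IsHomogeneous (∑ a, v a) :=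
  IsHomogeneous.prod _ _ _ fun a _ => by simpa using (isHomogeneous_X ℝ a).pow (v a)

theorem sum_X_isHomogeneous : (∑ a : A, X a : MvPolynomial A ℝ).IsHomogeneous 1 :=
  IsHomogeneous.sum _ _ _ fun a _ => isHomogeneous_X ℝ a

/-- A strictly copositive Laurent polynomial has, up to a power of the monomial sum, a lift which is
positive on the whole simplex. -/
theorem exists_lift_pos_on_stdSimplex (hf : f ∈ laurentOn (kfold k A))
    (h : StrictlyCopositive A k f) :
    ∃ (E : ℕ) (G : MvPolynomial A ℝ), G.IsHomogeneous (E + k) ∧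
      param 1 G = monomialSum A ^ E * f ∧ ∀ x ∈ stdSimplex ℝ A, 0 < eval x G := by
  classical
  obtain ⟨V, hV⟩ := exists_isDecompMatrix A k
  let T := {p : (A → ℕ) × (A → ℕ) //
    ∑ a, p.1 a = ∑ a, p.2 a ∧ latticeSum p.1 = latticeSum p.2}
  let g : T → MvPolynomial A ℝ := fun p => ∏ a, X a ^ p.1.1 a - ∏ a, X a ^ p.1.2 a
  let deg : T → ℕ := fun p => ∑ a, p.1.1 a
  have hg : ∀ p, (g p).IsHomogeneous (deg p) := fun p =>
    (prod_X_pow_isHomogeneous _).sub (by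
      simp only [p.2.1]; exact prod_X_pow_isHomogeneous _)
  have hg0 : ∀ p, param 1 (g p) = 0 := fun p => by
    rw [map_sub, param_prod_X_pow, param_prod_X_pow, p.2.2]
    simp
  have hcont : ∀ P : MvPolynomial A ℝ, Continuous fun y : A → ℝ => eval y P := fun P =>
    P.continuous_eval
  have hK : IsCompact (stdSimplex ℝ A ∩ {y | eval y (lift V f) ≤ 0}) :=
    (isCompact_stdSimplex (𝕜 := ℝ) A).inter_right (isClosed_le (hcont _) continuous_const)
  -- Where the lift is nonpositive on the simplex, copositivity excludes toric points, so some
  -- binomial is nonzero; finitely many suffice.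
  obtain ⟨t, ht⟩ := hK.elim_finite_subcover (fun p : T => {y | eval y (g p) ≠ 0})
    (fun p => isOpen_ne_fun (hcont _) continuous_const) (by
      rintro y ⟨hy, hy0⟩
      by_contra hcov
      simp only [Set.mem_iUnion, not_exists, Set.mem_ofPred_eq, not_not] at hcov
      refine (h V hV y (mem_nonnegToric_iff.2 ⟨hy.1, fun d b v w hv hw => ?_⟩) ?_).not_ge hy0
      · have := hcov ⟨(v, w), hv.1.trans hw.1.symm, hv.2.trans hw.2.symm⟩
        simpa [g, sub_eq_zero] using this
      · rintro rfl
        simpa using hy.2)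
  obtain ⟨c, hc⟩ := exists_forall_add_mul_pos (isCompact_stdSimplex (𝕜 := ℝ) A)
    (hcont (lift V f)) (h := fun y => ∑ p ∈ t, eval y (g p) ^ 2)
    (continuous_finsetSum _ fun p _ => (hcont _).pow 2)
    (fun y => Finset.sum_nonneg fun p _ => sq_nonneg _) (fun y hy => by
      refine or_iff_not_imp_left.2 fun hy0 => ?_
      obtain ⟨p, hp, hpy⟩ := Set.mem_iUnion₂.1 (ht ⟨hy, not_lt.1 hy0⟩)
      exact Finset.sum_pos' (fun p _ => sq_nonneg _) ⟨p, hp, sq_pos_of_ne_zero hpy⟩)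
  -- Any `E` bounding each `2 * deg p` lets powers of `σ` equalize degrees; `σ = 1` on the simplex,
  -- so positivity is unaffected.
  let E := ∑ p ∈ t, 2 * deg p
  let σ : MvPolynomial A ℝ := ∑ a, X a
  refine ⟨E, σ ^ E * lift V f + C (c : ℝ) * ∑ p ∈ t, σ ^ (E + k - 2 * deg p) * g p ^ 2,
    ?_, ?_, fun y hy => ?_⟩
  · have hσ : ∀ e, (σ ^ e).IsHomogeneous e := fun e => by
      simpa only [one_mul] using sum_X_isHomogeneous.pow e
    refine ((hσ E).mul (lift_isHomogeneous hV hf)).add (IsHomogeneous.C_mul ?_ _)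
    refine IsHomogeneous.sum _ _ _ fun p hp => ?_
    have hle : 2 * deg p ≤ E := Finset.single_le_sum (f := fun p => 2 * deg p) (by simp) hp
    have := (hσ (E + k - 2 * deg p)).mul ((hg p).pow 2)
    rwa [show E + k - 2 * deg p + deg p * 2 = E + k by omega] at this
  · have hsum : param 1 (∑ p ∈ t, σ ^ (E + k - 2 * deg p) * g p ^ 2) = 0 := by
      rw [map_sum]
      exact Finset.sum_eq_zero fun p _ => by
        rw [map_mul, map_pow _ (g p), hg0, zero_pow two_ne_zero, mul_zero]
    rw [map_add, map_mul, map_mul, hsum, mul_zero, add_zero, map_pow, param_one_sum_X,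
      param_one_lift hV hf]
  · have hσ : eval y σ = 1 := by simpa [σ] using hy.2
    simpa [hσ, -map_sum, map_sum (eval y)] using hc y hy

theorem exists_pow_hasPosCoeffs (hf : f ∈ laurentOn (kfold k A)) (h : StrictlyCopositive A k f) :
    ∃ M : ℕ, monomialSum A ^ M * f ∈ laurentOn (kfold (k + M) A) ∧
      HasPosCoeffs (kfold (k + M) A) (monomialSum A ^ M * f) := by
  obtain ⟨E, G, hG, hGf, hGpos⟩ := exists_lift_pos_on_stdSimplex hf h
  obtain ⟨M, hM⟩ := exists_pow_mul_coeff_pos hG hGpos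
  have hhom : ((∑ a, X a) ^ M * G).IsHomogeneous (k + (M + E)) := by
    have := (sum_X_isHomogeneous (A := A)).pow M |>.mul hG
    rwa [show 1 * M + (E + k) = k + (M + E) by ring] at this
  have hparam : param 1 ((∑ a, X a) ^ M * G) = monomialSum A ^ (M + E) * f := by
    rw [map_mul, map_pow, param_one_sum_X, hGf, pow_add, mul_assoc]
  refine ⟨M + E, hparam ▸ param_one_mem_laurentOn hhom, fun b ⟨v, hv, hvb⟩ => ?_⟩
  rw [← hparam, coeff_param]
  have hpos : ∀ w : A →₀ ℕ, ∑ a, w a = k + (M + E) → 0 < coeff w ((∑ a, X a) ^ M * G) :=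
    fun w hw => hM w (by omega)
  refine Finset.sum_pos (fun w hw => ?_) ⟨Finsupp.equivFunOnFinite.symm v, ?_⟩
  · simpa using hpos w (sum_eq_of_mem_support hhom (Finset.mem_filter.1 hw).1)
  · rw [Finset.mem_filter, mem_support_iff]
    exact ⟨(hpos _ (by simpa using hv)).ne', by simpa [latticeSum] using hvb⟩

/-- If every monomial of `f` vanishes at a nonnegative point of the toric variety and the Newton
polytope of `f` is full, then the point is the origin. -/
theorem eq_zero_of_monomials_eq_zero (hf : f ∈ laurentOn (kfold k A))
    (hnewt : newt f = conv (kfold k A)) {V : (Fin n → ℤ) → A → ℕ} (hV : IsDecompMatrix A k V)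
    {y : A → ℝ} (hy : SatisfiesBinomials y)
    (h0 : ∀ b ∈ f.coeff.support, ∏ a, y a ^ V b a = 0) : y = 0 := by
  classical
  funext a
  have hka : k • (a : Fin n → ℤ) ∈ kfold k A :=
    ⟨Pi.single a k, by simp, by simp [Pi.single_apply, ite_smul]⟩
  have hmem : latticeToReal (k • (a : Fin n → ℤ)) ∈ conv (f.coeff.support : Set (Fin n → ℤ)) := by
    rw [← newt, hnewt]
    exact subset_convexHull ℝ _ ⟨_, hka, rfl⟩
  -- A positive multiple of `k • a` is a sum of exponents of `f`, so a binomial equates a power of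
  -- `y a` with a product of vanishing monomials.
  obtain ⟨ι, _, b, m, hbS, ⟨i₀, hi₀⟩, hsum⟩ := exists_nat_combination_of_mem_conv hmem
  have hVb : ∀ i, IsDecomp A k (b i) (V (b i)) := fun i => hV _ (hf (hbS i))
  have h1 : IsDecomp A ((∑ i, m i) * k) ((∑ i, m i) • k • (a : Fin n → ℤ))
      (fun a => ∑ i, m i * V (b i) a) := by
    constructor
    · rw [Finset.sum_comm, Finset.sum_mul]
      simp only [← Finset.mul_sum, (hVb _).1]
    · rw [← hsum]
      simp only [Finset.sum_smul, mul_smul]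
      rw [Finset.sum_comm]
      simp only [← Finset.smul_sum, (hVb _).2]
  have h2 : IsDecomp A ((∑ i, m i) * k) ((∑ i, m i) • k • (a : Fin n → ℤ))
      (Pi.single a ((∑ i, m i) * k)) :=
    ⟨by simp, by simp [Pi.single_apply, ite_smul, mul_smul]⟩
  have h3 := hy _ _ _ _ h1 h2
  have h4 : ∏ a, y a ^ (∑ i, m i * V (b i) a) = 0 := by
    simp only [← Finset.prod_pow_eq_pow_sum, mul_comm (m _), pow_mul]
    rw [Finset.prod_comm]
    simp only [Finset.prod_pow]
    exact Finset.prod_eq_zero (mem_univ i₀) (by rw [h0 _ (hbS i₀), zero_pow hi₀.ne'])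
  rw [h4, Finset.prod_eq_single a (fun c _ hc => by simp [hc]) (by simp), Pi.single_eq_same] at h3
  exact eq_zero_of_pow_eq_zero h3.symm

theorem strictlyCopositive_of_hasNonnegCoeffs (hf : f ∈ laurentOn (kfold k A))
    (hnewt : newt f = conv (kfold k A)) {N : ℕ}
    (hN : HasNonnegCoeffs (monomialSum A ^ N * f)) : StrictlyCopositive A k f := by
  classical
  intro V hV y hy hy0
  obtain ⟨hnn, hbin⟩ := mem_nonnegToric_iff.1 hy
  have hF := lift_isHomogeneous hV hf
  let P : MvPolynomial A ℝ := (∑ a, X a) ^ N * lift V f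
  have hP : P.IsHomogeneous (N + k) := by
    simpa only [one_mul] using ((sum_X_isHomogeneous (A := A)).pow N).mul hF
  have hP1 : param 1 P = monomialSum A ^ N * f := by
    simp only [P, map_mul, map_pow, param_one_sum_X, param_one_lift hV hf]
  have hcoeff : ∀ b, 0 ≤ (param y P).coeff b := fun b => by
    by_cases hb : b ∈ kfold (N + k) A
    · obtain ⟨w, hw⟩ := hb
      rw [coeff_param_eq hP hbin hw, hP1]
      exact mul_nonneg (hN b) (Finset.prod_nonneg fun a _ => pow_nonneg (hnn a) _)
    · rw [coeff_param_eq_zero hP y hb]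
  have hsum : 0 < ∑ a, y a := by
    obtain ⟨a, ha⟩ := Function.ne_iff.1 hy0
    exact Finset.sum_pos' (fun a _ => hnn a) ⟨a, mem_univ a, (hnn a).lt_of_ne' ha⟩
  have hevP : eval y P = (∑ a, y a) ^ N * eval y (lift V f) := by simp [P]
  have hnonneg : 0 ≤ eval y P := by
    rw [← sum_coeff_param]
    exact Finset.sum_nonneg fun b _ => hcoeff b
  have hFnn : 0 ≤ eval y (lift V f) :=
    nonneg_of_mul_nonneg_right (hevP ▸ hnonneg) (pow_pos hsum N)
  refine hFnn.lt_of_ne' fun hzero => hy0 ?_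
  have hPzero : param y P = 0 := by
    have h1 : (param y P).coeff.sum (fun _ r => r) = 0 := by
      rw [sum_coeff_param, hevP, hzero, mul_zero]
    have h2 := (Finset.sum_eq_zero_iff_of_nonneg fun b _ => hcoeff b).1 h1
    ext b
    by_cases hb : b ∈ (param y P).coeff.support
    · simpa using h2 b hb
    · simpa using hb
  have hσ : param y (∑ a, X a) ≠ 0 := fun h => by
    have := sum_coeff_param y (∑ a, X a)
    rw [h] at this
    simp at this
    exact hsum.ne this
  have hFzero : param y (lift V f) = 0 := by
    rw [map_mul, map_pow] at hPzero
    exact (mul_eq_zero.1 hPzero).resolve_left (pow_ne_zero N hσ)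
  refine eq_zero_of_monomials_eq_zero hf hnewt hV hbin fun b hb => ?_
  have h1 := coeff_param_eq hF hbin (hV b (hf (Finset.mem_coe.2 hb)))
  rw [hFzero, param_one_lift hV hf] at h1
  exact (mul_eq_zero.1 h1.symm).resolve_left (Finsupp.mem_support_iff.1 hb)

end Main

end SparsePolya

theorem theorem3p5 {n : ℕ} (A : Finset (Fin n → ℤ)) (hA : A.Nonempty) (k : ℕ)
    (f : SparsePolya.Laurent n) (hf : f ∈ SparsePolya.laurentOn (SparsePolya.kfold k A)) :
    List.TFAE [
      SparsePolya.StrictlyCopositive A k f,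
      SparsePolya.newt f = SparsePolya.conv (SparsePolya.kfold k A) ∧
        ∃ M : ℕ,
          SparsePolya.monomialSum A ^ M * f ∈
            SparsePolya.laurentOn (SparsePolya.kfold (k + M) A) ∧
          SparsePolya.HasPosCoeffs (SparsePolya.kfold (k + M) A)
            (SparsePolya.monomialSum A ^ M * f),
      SparsePolya.newt f = SparsePolya.conv (SparsePolya.kfold k A) ∧
        ∃ N : ℕ,
          SparsePolya.monomialSum A ^ N * f ∈
            SparsePolya.laurentOn (SparsePolya.kfold (k + N) A) ∧
          SparsePolya.HasNonnegCoeffs (SparsePolya.monomialSum A ^ N * f)] := by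
  tfae_have 1 → 2 := fun h =>
    ⟨SparsePolya.newt_eq_conv_of_strictlyCopositive hA hf h,
      SparsePolya.exists_pow_hasPosCoeffs hf h⟩
  tfae_have 2 → 3 := by
    rintro ⟨hnewt, M, hsupp, hpos⟩
    refine ⟨hnewt, M, hsupp, fun b => ?_⟩
    by_cases hb : b ∈ (SparsePolya.monomialSum A ^ M * f).coeff.support
    · exact (hpos b (hsupp hb)).le
    · exact (Finsupp.notMem_support_iff.1 hb).ge
  tfae_have 3 → 1 := fun ⟨hnewt, _, _, hN⟩ =>
    SparsePolya.strictlyCopositive_of_hasNonnegCoeffs hf hnewt hN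
  tfae_finish
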